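/- Let $m\ge 2$, $M=\{1,\dots,m\}$, and for each $s\in M$ let $A^s$ be a finite set with $|A^s|\ge 2$ and $\prec^s$ a linear order on $A^s$; let $A=\times_{s\in M}A^s$. A preference over a finite set is a linear order on it, $a\mathrel{P}b$ meaning that $a$ is strictly preferred to $b$, and $r_k(P)$ is its $k$-th ranked element. For $a^s,b^s\in A^s$ let $\langle a^s,b^s\rangle$ (resp. $\mathrm{Int}\langle a^s,b^s\rangle$) be the set of elements lying weakly (resp. strictly) between $a^s$ and $b^s$ with respect to $\prec^s$, in either order. Let $\underline{x},\overline{x}\in A$ be thresholds, i.e. for each $s$ either $\underline{x}^s=\overline{x}^s$, or $\underline{x}^s\ne\overline{x}^s$ and $|\langle\underline{x}^s,\overline{x}^s\rangle|\ge 3$. Let $\mathbb{D}$ be a set of preferences over $A$ that is minimally rich: each $a\in A$ is $r_1(P)$ for some $P\in\mathbb{D}$. For $P\in\mathbb{D}$ with $r_1(P)=x$, the induced marginal preference $[P]^s$ on $A^s$ is defined by $a^s\mathrel{[P]^s}b^s\Leftrightarrow(a^s,x^{-s})\mathrel{P}(b^s,x^{-s})$, and $[\mathbb{D}]^s=\{[P]^s:P\in\mathbb{D}\}$.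 Two elements $a^s,b^s$ of $A^s$ are strongly connected if there are $Q,Q'\in[\mathbb{D}]^s$ with $r_1(Q)=r_2(Q')=a^s$, $r_2(Q)=r_1(Q')=b^s$ and $r_k(Q)=r_k(Q')$ for $k=3,\dots,|A^s|$; let $G^{B}$ be the graph of strong connectedness on a nonempty $B\subseteq A^s$. Assume that $\mathbb{D}$ is a multidimensional hybrid domain on $\prec$ with respect to $\underline{x}$ and $\overline{x}$: 1. for each $P\in\mathbb{D}$, say $r_1(P)=x$, and all $a,b\in A$ that disagree in exactly one component $s$, we have $a\mathrel{P}b$ if $a^s=x^s$, and also if $a^s\in\mathrm{Int}\langle x^s,b^s\rangle$ and $a^s\notin\mathrm{Int}\langle\underline{x}^s,\overline{x}^s\rangle$; 2. for each $s\in M$, the graph $G^{A^s}$ is connected and, if $\underline{x}^s\neq\overline{x}^s$, the graph $G^{\langle\underline{x}^s,\overline{x}^s\rangle}$ has no leaf (vertex with exactly one neighbour). Let $N=\{1,\dots,n\}$ with $n\ge 2$, $s\in M$ and $f^s:\big[[\mathbb{D}]^s\big]^n\to A^s$. It is called a strategy-proof marginal rule if it is unanimous ($f^s(Q_1,\dots,Q_n)=a^s$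 whenever $r_1(Q_i)=a^s$ for all $i$) and strategy-proof ($f^s(Q_i,Q_{-i})\ne f^s(Q_i',Q_{-i})$ implies $f^s(Q_i,Q_{-i})\mathrel{Q_i}f^s(Q_i',Q_{-i})$ for all $i\in N$, $Q_i,Q_i'\in[\mathbb{D}]^s$ and $Q_{-i}\in\big[[\mathbb{D}]^s\big]^{n-1}$). It is a fixed ballot rule (FBR) on $\prec^s$ if there are $b_J\in A^s$ for $J\subseteq N$ with $b_\emptyset=\min^{\prec^s}A^s$, $b_N=\max^{\prec^s}A^s$, and $b_J\preccurlyeq^s b_{J'}$ whenever $J\subset J'$, such that for all profiles $$f^s(Q_1,\dots,Q_n)=\max_{J\subseteq N}{}^{\prec^s}\min{}^{\prec^s}\big(\{r_1(Q_i):i\in J\}\cup\{b_J\}\big).$$ For $y\prec^s z$ in $A^s$ it is a $(y,z)$-FBR if moreover the $b_J$ can be chosen so that, for some $i\in N$, $z\preccurlyeq^s b_J$ for all $J\ni i$ and $b_J\preccurlyeq^s y$ for all $J\not\ni i$. Then: (i) if $\underline{x}^s=\overline{x}^s$, then $f^s$ is a strategy-proof marginal rule if and only if it is an FBR; (ii)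 if $\underline{x}^s\neq\overline{x}^s$, then $f^s$ is a strategy-proof marginal rule if and only if it is a $(y,z)$-FBR, where $y$ and $z$ are respectively the $\prec^s$-smaller and the $\prec^s$-larger of $\underline{x}^s$ and $\overline{x}^s$ (so $(y,z)=(\underline{x}^s,\overline{x}^s)$ if $\underline{x}^s\prec^s\overline{x}^s$). -/

import Mathlib

/-- A (strict) preference over `X`: a linear order, presented by its strict part,
`P.rel a b` meaning that `a` is strictly preferred to `b`. -/
structure Pref (X : Type*) where
  rel : X → X → Prop
  irrefl : ∀ a, ¬ rel a a
  trans : ∀ a b c, rel a b → rel b c → rel a c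
  total : ∀ a b, a ≠ b → rel a b ∨ rel b a

namespace Pref

/-- The position of `a` in the preference `P`: the alternative `r_k(P)` is the one of rank `k`. -/
noncomputable def rank {X : Type*} (P : Pref X) (a : X) : ℕ :=
  {b | P.rel b a}.ncard + 1

theorem exists_top {X : Type*} [Finite X] [Nonempty X] (P : Pref X) :
    ∃ a, ∀ b, b ≠ a → P.rel a b := by
  have : IsTrans X P.rel := ⟨P.trans⟩
  have : Std.Irrefl P.rel := ⟨P.irrefl⟩
  obtain ⟨a, -, ha⟩ := (Finite.wellFounded_of_trans_of_irrefl P.rel).has_min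
    Set.univ Set.univ_nonempty
  exact ⟨a, fun b hb => (P.total a b hb.symm).resolve_right (ha b trivial)⟩

/-- The peak `r_1(P)` of a preference. -/
noncomputable def top {X : Type*} [Finite X] [Nonempty X] (P : Pref X) : X :=
  P.exists_top.choose

theorem rel_top {X : Type*} [Finite X] [Nonempty X] (P : Pref X) {b : X} (hb : b ≠ P.top) :
    P.rel P.top b :=
  P.exists_top.choose_spec b hb

theorem rank_top {X : Type*} [Finite X] [Nonempty X] (P : Pref X) : P.rank P.top = 1 := by
  have h : {b | P.rel b P.top} = ∅ := by
    ext b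
    simp only [Set.mem_ofPred_eq, Set.mem_empty_iff_false, iff_false]
    intro hb
    by_cases hbt : b = P.top
    · exact P.irrefl _ (hbt ▸ hb)
    · exact P.irrefl _ (P.trans _ _ _ hb (P.rel_top hbt))
  simp [rank, h]

/-- The induced marginal preference `[P]^s`: `x` is compared with `y` by comparing `(x, a^{-s})`
with `(y, a^{-s})` in `P`, where `a` is the peak of `P`. -/
noncomputable def marginal {m : ℕ} {A : Fin m → Type*} [∀ s, Finite (A s)] [∀ s, Nonempty (A s)]
    (P : Pref (∀ s, A s)) (s : Fin m) : Pref (A s) where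
  rel x y := P.rel (Function.update P.top s x) (Function.update P.top s y)
  irrefl _ := P.irrefl _
  trans _ _ _ := P.trans _ _ _
  total _ _ h := P.total _ _ fun e => h (Function.update_injective P.top s e)

end Pref

/-- Every alternative is the peak of some preference of the domain. -/
def MinimallyRich {X : Type*} [Finite X] [Nonempty X] (D : Set (Pref X)) : Prop :=
  ∀ a, ∃ P ∈ D, P.top = a

/-- The induced marginal domain `[D]^s`. -/
def inducedDomain {m : ℕ} {A : Fin m → Type*} [∀ s, Finite (A s)] [∀ s, Nonempty (A s)]
    (D : Set (Pref (∀ s, A s))) (s : Fin m) : Set (Pref (A s)) :=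
  {Q | ∃ P ∈ D, P.marginal s = Q}

/-! Social choice functions `f : Dⁿ → X`. -/

/-- `f` is unanimous (in which case it is called a rule). -/
def Unanimous {X : Type*} [Finite X] [Nonempty X] {D : Set (Pref X)} {n : ℕ}
    (f : (Fin n → D) → X) : Prop :=
  ∀ (a : X) (P : Fin n → D), (∀ i, (P i).1.top = a) → f P = a

def StrategyProof {X : Type*} {D : Set (Pref X)} {n : ℕ} (f : (Fin n → D) → X) : Prop :=
  ∀ (i : Fin n) (P : Fin n → D) (Q : D),
    f P ≠ f (Function.update P i Q) → (P i).1.rel (f P) (f (Function.update P i Q))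

/-- A strategy-proof rule is a unanimous and strategy-proof social choice function. -/
def StrategyProofRule {X : Type*} [Finite X] [Nonempty X] {D : Set (Pref X)} {n : ℕ}
    (f : (Fin n → D) → X) : Prop :=
  Unanimous f ∧ StrategyProof f

/-! Multidimensional hybrid domains. The closed interval `⟨a, b⟩` of a linear order, for `a` and
`b` in either order, is `Set.uIcc a b`. -/

/-- `Int⟨a, b⟩`: the elements strictly between `a` and `b`, for `a` and `b` in either order. -/
def intBetween {X : Type*} [LinearOrder X] (a b : X) : Set X :=
  {x | (a < x ∧ x < b) ∨ (b < x ∧ x < a)}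

def MarginalThresholds {X : Type*} [LinearOrder X] (lo hi : X) : Prop :=
  lo = hi ∨ (lo ≠ hi ∧ 3 ≤ (Set.uIcc lo hi).ncard)

def Thresholds {m : ℕ} {A : Fin m → Type*} [∀ s, LinearOrder (A s)] (lo hi : ∀ s, A s) : Prop :=
  ∀ s, MarginalThresholds (lo s) (hi s)

/-- `M(a, b)`: the components on which `a` and `b` disagree. -/
def disagreement {m : ℕ} {A : Fin m → Type*} (a b : ∀ s, A s) : Set (Fin m) :=
  {s | a s ≠ b s}

/-- `P` is multidimensional hybrid w.r.t. `lo` and `hi`, on the given component orders. -/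
def MultidimHybrid {m : ℕ} {A : Fin m → Type*} [∀ s, Finite (A s)] [∀ s, Nonempty (A s)]
    [∀ s, LinearOrder (A s)] (lo hi : ∀ s, A s) (P : Pref (∀ s, A s)) : Prop :=
  ∀ (a b : ∀ s, A s) (s : Fin m), disagreement a b = {s} →
    (a s = P.top s → P.rel a b) ∧
    (a s ∈ intBetween (P.top s) (b s) ∧ a s ∉ intBetween (lo s) (hi s) → P.rel a b)

/-- `P` and `Q` have `a` and `b`, respectively `b` and `a`, as their first and second ranked
elements, and agree on all the other ranks. -/
def TopSwap {X : Type*} (P Q : Pref X) (a b : X) : Prop :=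
  P.rank a = 1 ∧ Q.rank a = 2 ∧ Q.rank b = 1 ∧ P.rank b = 2 ∧
    ∀ k, 3 ≤ k → k ≤ Nat.card X → ∀ c, P.rank c = k ↔ Q.rank c = k

/-- The graph of strong connectedness of elements with respect to a domain. -/
def strongGraph {X : Type*} (D : Set (Pref X)) : SimpleGraph X where
  Adj a b := ∃ P ∈ D, ∃ Q ∈ D, TopSwap P Q a b
  symm := ⟨by
    rintro a b ⟨P, hP, Q, hQ, h1, h2, h3, h4, h5⟩
    exact ⟨Q, hQ, P, hP, h3, h4, h1, h2, fun k hk hk' c => (h5 k hk hk' c).symm⟩⟩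
  loopless := ⟨by
    rintro a ⟨P, _, Q, _, h1, _, _, h4, _⟩
    omega⟩

/-- A leaf is a vertex with exactly one neighbour. -/
def HasLeaf {V : Type*} (G : SimpleGraph V) : Prop :=
  ∃ v, ∃! w, G.Adj v w

/-- `D` is a multidimensional hybrid domain w.r.t. the thresholds `lo` and `hi`. -/
structure MultidimHybridDomain {m : ℕ} {A : Fin m → Type*} [∀ s, Finite (A s)]
    [∀ s, Nonempty (A s)] [∀ s, LinearOrder (A s)] (lo hi : ∀ s, A s)
    (D : Set (Pref (∀ s, A s))) : Prop where
  thresholds : Thresholds lo hi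
  hybrid : ∀ P ∈ D, MultidimHybrid lo hi P
  connected : ∀ s, (strongGraph (inducedDomain D s)).Connected
  no_leaf : ∀ s ∈ disagreement lo hi,
    ¬ HasLeaf ((strongGraph (inducedDomain D s)).induce (Set.uIcc (lo s) (hi s)))

/-! Fixed ballot rules. -/

/-- Ballot unanimity and monotonicity of a family of ballots indexed by coalitions. -/
structure FixedBallots {X : Type*} [LinearOrder X] {n : ℕ} (b : Finset (Fin n) → X) : Prop where
  empty : ∀ x, b ∅ ≤ x
  univ : ∀ x, x ≤ b Finset.univ
  mono : ∀ J J' : Finset (Fin n), J ⊂ J' → b J ≤ b J'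

/-- The outcome `max_J min {t_i (i ∈ J), b_J}` for the profile of peaks `t`. -/
def ballotOutcome {X : Type*} [LinearOrder X] {n : ℕ} (b : Finset (Fin n) → X) (t : Fin n → X) :
    X :=
  Finset.univ.sup' Finset.univ_nonempty fun J : Finset (Fin n) =>
    (insert (b J) (J.image t)).min' (Finset.insert_nonempty _ _)

/-- `f` is a fixed ballot rule. -/
def IsFBR {X : Type*} [Finite X] [Nonempty X] [LinearOrder X] {D : Set (Pref X)} {n : ℕ}
    (f : (Fin n → D) → X) : Prop :=
  ∃ b : Finset (Fin n) → X, FixedBallots b ∧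
    ∀ P, f P = ballotOutcome b fun i => (P i).1.top

/-- The constrained-dictatorship condition on ballots, for `lo < hi`. -/
def ConstrainedDictatorship {X : Type*} [LinearOrder X] {n : ℕ} (lo hi : X)
    (b : Finset (Fin n) → X) : Prop :=
  ∃ i, ∀ J : Finset (Fin n), (i ∈ J → hi ≤ b J) ∧ (i ∉ J → b J ≤ lo)

/-- `f` is a `(lo, hi)`-fixed ballot rule, for `lo < hi`. -/
def IsConstrainedFBR {X : Type*} [Finite X] [Nonempty X] [LinearOrder X] {D : Set (Pref X)}
    {n : ℕ} (lo hi : X) (f : (Fin n → D) → X) : Prop :=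
  ∃ b : Finset (Fin n) → X, FixedBallots b ∧ ConstrainedDictatorship lo hi b ∧
    ∀ P, f P = ballotOutcome b fun i => (P i).1.top

/-! An outcome in a finite linear order is known once it is known on which side of each cut between
consecutive elements it lies. A fixed ballot rule decides each cut through the coalition of voters
with peaks beyond it (`FixedBallots.le_ballotOutcome_iff`). Such a rule cannot be manipulated where
preferences are single-peaked; strictly between the thresholds, the constrained ballots leave the
decision to one voter (`FixedBallots.strategyProofRule`).

For the converse, fix all voters but two. Between the thresholds, swaps along the edges of a
connected leafless graph force one of the two to win at every edge
(`LeaflessCore.first_all_or_second_all`); at a cut outside, only the sides of the peaks matter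
(`DiagonalHybrid.cut_right`). The two-voter function need not be unanimous, since the fixed voters
constrain it. What replaces unanimity is knowledge of its diagonal, which is a section of the rule
with the two voters merged. Hence an induction on the number of voters (`CutDetermined.of_merged`),
after which the ballots are the outcomes at profiles of extreme peaks
(`StrategyProofRule.exists_ballots`).

If the thresholds coincide, all conditions about the interval between them are vacuous, so one
argument serves both cases. -/

namespace Pref

variable {X : Type*}

theorem asymm (P : Pref X) {a b : X} (h : P.rel a b) : ¬ P.rel b a :=
  fun h' => P.irrefl _ (P.trans _ _ _ h h')

theorem ne_of_rel (P : Pref X) {a b : X} (h : P.rel a b) : a ≠ b :=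
  fun e => P.irrefl _ (e ▸ h)

theorem rank_lt_rank [Finite X] (P : Pref X) {a b : X} (h : P.rel a b) : P.rank a < P.rank b := by
  unfold rank
  refine Nat.add_lt_add_right (Set.ncard_lt_ncard ⟨fun c hc => P.trans _ _ _ hc h, fun hs => ?_⟩
    (Set.toFinite _)) 1
  exact P.irrefl a (hs h)

theorem rel_iff_rank_lt [Finite X] (P : Pref X) {a b : X} : P.rel a b ↔ P.rank a < P.rank b := by
  refine ⟨P.rank_lt_rank, fun h => ?_⟩
  have hne : a ≠ b := by rintro rfl; exact lt_irrefl _ h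
  exact (P.total a b hne).resolve_right fun h' => lt_asymm h (P.rank_lt_rank h')

theorem rank_injective [Finite X] (P : Pref X) : Function.Injective P.rank := by
  intro a b h
  by_contra hne
  rcases P.total a b hne with h' | h' <;> have := P.rank_lt_rank h' <;> omega

theorem one_le_rank (P : Pref X) (a : X) : 1 ≤ P.rank a := Nat.le_add_left _ _

theorem rank_le_card [Finite X] (P : Pref X) (a : X) : P.rank a ≤ Nat.card X := by
  have : {b | P.rel b a} ≠ Set.univ := fun h => P.irrefl a (h ▸ Set.mem_univ a : a ∈ {b | P.rel b a})
  exact Set.ncard_lt_card this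

theorem eq_top_of_forall [Finite X] [Nonempty X] (P : Pref X) {a : X}
    (h : ∀ b, b ≠ a → P.rel a b) : P.top = a := by
  by_contra hne
  exact P.asymm (h _ hne) (P.rel_top (Ne.symm hne))

theorem not_rel_top [Finite X] [Nonempty X] (P : Pref X) (a : X) : ¬ P.rel a P.top := fun h =>
  P.asymm h (P.rel_top (P.ne_of_rel h))

theorem eq_top_of_rank [Finite X] [Nonempty X] (P : Pref X) {a : X} (h : P.rank a = 1) :
    P.top = a :=
  P.rank_injective (P.rank_top.trans h.symm)

end Pref

/-! ### Swap pairs and two-voter functions -/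

/-- `P` has peak `a`, `Q` has peak `b`, each ranks the peak of the other second, and `a`, `b` is
the only pair on which they differ. -/
structure SwapPair {X : Type*} [Finite X] [Nonempty X] (P Q : Pref X) (a b : X) : Prop where
  top_left : P.top = a
  top_right : Q.top = b
  ne : a ≠ b
  second_left : ∀ z, z ≠ a → z ≠ b → P.rel b z
  second_right : ∀ z, z ≠ a → z ≠ b → Q.rel a z
  swap : ∀ x y, P.rel x y → Q.rel y x → x = a ∧ y = b

theorem SwapPair.symm {X : Type*} [Finite X] [Nonempty X] {P Q : Pref X} {a b : X}
    (h : SwapPair P Q a b) : SwapPair Q P b a where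
  top_left := h.top_right
  top_right := h.top_left
  ne := h.ne.symm
  second_left z hb ha := h.second_right z ha hb
  second_right z hb ha := h.second_left z ha hb
  swap x y hxy hyx := (h.swap y x hyx hxy).symm

theorem TopSwap.swapPair {X : Type*} [Finite X] [Nonempty X] {P Q : Pref X} {a b : X}
    (h : TopSwap P Q a b) : SwapPair P Q a b := by
  obtain ⟨hPa, hQa, hQb, hPb, hk⟩ := h
  have key : ∀ z, z ≠ a → z ≠ b → 3 ≤ P.rank z ∧ Q.rank z = P.rank z := by
    intro z hza hzb
    have h1 := P.rank_injective.ne hza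
    have h2 := P.rank_injective.ne hzb
    have h3 := P.one_le_rank z
    have h4 : 3 ≤ P.rank z := by omega
    exact ⟨h4, (hk _ h4 (P.rank_le_card z) z).1 rfl⟩
  have hne : a ≠ b := by rintro rfl; omega
  refine ⟨P.eq_top_of_rank hPa, Q.eq_top_of_rank hQb, hne, fun z hza hzb => ?_,
    fun z hza hzb => ?_, fun x y hxy hyx => ?_⟩
  · have := key z hza hzb
    rw [P.rel_iff_rank_lt]; omega
  · have := key z hza hzb
    rw [Q.rel_iff_rank_lt]; omega
  · rw [Pref.rel_iff_rank_lt] at hxy hyx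
    by_cases hxa : x = a
    · refine ⟨hxa, ?_⟩
      subst hxa
      by_contra hyb
      have := key y (by rintro rfl; omega) hyb
      omega
    · exfalso
      by_cases hxb : x = b
      · subst hxb
        have := Q.one_le_rank y
        omega
      · have hx := key x hxa hxb
        have hy := key y (by rintro rfl; omega) (by rintro rfl; omega)
        omega

/-- Strategy-proofness of a two-voter social choice function. -/
structure TwoSP {X : Type*} {D : Set (Pref X)} (h : D → D → X) : Prop where
  left : ∀ P P' Q, h P Q ≠ h P' Q → P.1.rel (h P Q) (h P' Q)
  right : ∀ P Q Q', h P Q ≠ h P Q' → Q.1.rel (h P Q) (h P Q')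

namespace TwoSP

variable {X : Type*} {D : Set (Pref X)} {h : D → D → X}

theorem flip (H : TwoSP h) : TwoSP (fun P Q => h Q P) :=
  ⟨fun P P' Q => H.right Q P P', fun P Q Q' => H.left Q Q' P⟩

variable [Finite X] [Nonempty X]

theorem left_top (H : TwoSP h) {P P' Q : D} {a : X} (hP : P.1.top = a) (h' : h P' Q = a) :
    h P Q = a := by
  by_contra hne
  have := H.left P P' Q (by rwa [h'])
  rw [h', ← hP] at this
  exact P.1.not_rel_top _ this

theorem right_top (H : TwoSP h) {P Q Q' : D} {a : X} (hQ : Q.1.top = a) (h' : h P Q' = a) :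
    h P Q = a := H.flip.left_top hQ h'

theorem left_swap (H : TwoSP h) {P P' Q : D} {a b : X} (hS : SwapPair P.1 P'.1 a b) :
    h P' Q = h P Q ∨ (h P Q = a ∧ h P' Q = b) := by
  by_cases hne : h P' Q = h P Q
  · exact Or.inl hne
  · exact Or.inr (hS.swap _ _ (H.left P P' Q (Ne.symm hne)) (H.left P' P Q hne))

theorem right_swap (H : TwoSP h) {P Q Q' : D} {a b : X} (hS : SwapPair Q.1 Q'.1 a b) :
    h P Q' = h P Q ∨ (h P Q = a ∧ h P Q' = b) := H.flip.left_swap hS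

/-- Reporting `R` secures `b`, the second choice of `P`, so truth-telling yields nothing worse. -/
theorem left_second (H : TwoSP h) {P P' R Q : D} {a b : X} (hS : SwapPair P.1 P'.1 a b)
    (hR : h R Q = b) : h P Q = a ∨ h P Q = b := by
  by_contra! hne
  refine P.1.asymm (hS.second_left _ hne.1 hne.2) ?_
  have := H.left P R Q (by rw [hR]; exact hne.2)
  rwa [hR] at this

theorem right_second (H : TwoSP h) {P Q Q' R : D} {a b : X} (hS : SwapPair Q.1 Q'.1 a b)
    (hR : h P R = b) : h P Q = a ∨ h P Q = b := H.flip.left_second hS hR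

end TwoSP

/-! ### Dictatorship on a leafless graph -/

/-- Voter 1 obtains `a` whenever the peaks are `a` and `b`. -/
def FirstWins {X : Type*} [Finite X] [Nonempty X] {D : Set (Pref X)} (h : D → D → X) (a b : X) :
    Prop :=
  ∀ P Q : D, P.1.top = a → Q.1.top = b → h P Q = a

/-- Voter 2 obtains `b` whenever the peaks are `a` and `b`. -/
def SecondWins {X : Type*} [Finite X] [Nonempty X] {D : Set (Pref X)} (h : D → D → X) (a b : X) :
    Prop :=
  ∀ P Q : D, P.1.top = a → Q.1.top = b → h P Q = b

/-- A graph `E` on a set `C` of alternatives which is connected and has no leaf, and all of whose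
edges are realised by a pair of preferences of `D`. -/
structure LeaflessCore {X : Type*} [Finite X] [Nonempty X] (D : Set (Pref X)) (C : Set X)
    (E : X → X → Prop) : Prop where
  rich : ∀ a, ∃ P : D, P.1.top = a
  symm : ∀ a b, E a b → E b a
  mem : ∀ a b, E a b → b ∈ C
  swap : ∀ a b, E a b → ∃ P Q : D, SwapPair P.1 Q.1 a b
  connected : ∀ a ∈ C, ∀ b ∈ C, Relation.ReflTransGen E a b
  no_leaf : ∀ a b, E a b → ∃ c, c ≠ a ∧ E b c

namespace LeaflessCore

variable {X : Type*} [Finite X] [Nonempty X] {D : Set (Pref X)} {h : D → D → X} {C : Set X}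
  {E : X → X → Prop}

theorem ne (L : LeaflessCore D C E) {a b : X} (hab : E a b) : a ≠ b := by
  obtain ⟨P, Q, hS⟩ := L.swap a b hab
  exact hS.ne

theorem not_both (L : LeaflessCore D C E) {a b : X} (hab : a ≠ b) (h1 : FirstWins h a b)
    (h2 : SecondWins h a b) : False := by
  obtain ⟨P, hP⟩ := L.rich a
  obtain ⟨Q, hQ⟩ := L.rich b
  exact hab ((h1 P Q hP hQ).symm.trans (h2 P Q hP hQ))

/-- The outcome at the single swap profile `(P₀, Q₀)` decides the edge for all preferences with
these peaks. -/
theorem first_or_second (L : LeaflessCore D C E) (H : TwoSP h)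
    (hu : ∀ P : D, P.1.top ∈ C → h P P = P.1.top) {a b : X} (hab : E a b) :
    FirstWins h a b ∨ SecondWins h a b := by
  have ha : a ∈ C := L.mem _ _ (L.symm _ _ hab)
  have hb : b ∈ C := L.mem _ _ hab
  have hu' : ∀ P Q : D, ∀ c ∈ C, P.1.top = c → Q.1.top = c → h P Q = c := by
    intro P Q c hc hP hQ
    exact H.right_top hQ ((hu P (hP ▸ hc)).trans hP)
  obtain ⟨P₀, Q₀, hS⟩ := L.swap a b hab
  -- a profile with one of the two swap preferences has outcome `a` or `b`
  have hl : ∀ Q : D, Q.1.top = b → h P₀ Q = a ∨ h P₀ Q = b := fun Q hQ =>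
    H.left_second hS (hu' Q₀ Q b hb hS.top_right hQ)
  have hr : ∀ P : D, P.1.top = a → h P Q₀ = b ∨ h P Q₀ = a := fun P hP =>
    H.right_second hS.symm (hu' P P₀ a ha hP hS.top_left)
  rcases hl Q₀ hS.top_right with h0 | h0
  · refine Or.inl fun P Q hP hQ => H.left_top hP (?_ : h P₀ Q = a)
    refine (hl Q hQ).resolve_right fun hb' => hS.ne ?_
    rw [← h0, H.right_top hS.top_right hb']
  · refine Or.inr fun P Q hP hQ => H.right_top hQ (?_ : h P Q₀ = b)
    refine (hr P hP).resolve_right fun ha' => hS.ne ?_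
    rw [← h0, H.left_top hS.top_left ha']

/-- If voter 2 won at `(b, c)`, the profile `(Pab, Pcb)` would have two outcomes: a swap of voter 2
keeps it at `a`, a swap of voter 1 keeps it at `c`. -/
theorem first_step (L : LeaflessCore D C E) (H : TwoSP h)
    (hu : ∀ P : D, P.1.top ∈ C → h P P = P.1.top) {a b c : X} (hab : E a b) (hbc : E b c)
    (hac : a ≠ c) (h1 : FirstWins h a b) : FirstWins h b c := by
  refine (L.first_or_second H hu hbc).resolve_right fun h2 => hac ?_
  obtain ⟨Pab, Pba, hS⟩ := L.swap a b hab
  obtain ⟨Pbc, Pcb, hS'⟩ := L.swap b c hbc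
  have e1 : h Pab Pcb = a := by
    have e := h1 Pab Pbc hS.top_left hS'.top_left
    rcases H.right_swap (P := Pab) hS' with e' | e'
    · rw [e', e]
    · exact absurd (e.symm.trans e'.1) hS.ne
  have e2 : h Pab Pcb = c := by
    have e := h2 Pba Pcb hS.top_right hS'.top_right
    rcases H.left_swap (Q := Pcb) hS.symm with e' | e'
    · rw [e', e]
    · exact absurd (e.symm.trans e'.1) hS'.ne.symm
  exact e1.symm.trans e2

/-- Orient an edge from `b` to `c` if `b` is chosen whichever of the two voters has peak `b`. A
voter 1 with peak `b` then excludes everything downstream: if `z` were attainable but its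
predecessor `y` were not, voter 2 with `y` first and `z` second would get `z`, although `y` prevails
over `z`. -/
theorem not_option (L : LeaflessCore D C E) (H : TwoSP h) {b x : X}
    (hbx : Relation.TransGen (fun b c => E b c ∧ FirstWins h b c ∧ SecondWins h c b) b x)
    {P : D} (hP : P.1.top = b) (Q : D) : h P Q ≠ x := by
  induction hbx generalizing Q with
  | single hx =>
    intro e
    obtain ⟨R, hR⟩ := L.rich _
    exact L.ne hx.1 ((hx.2.1 P R hP hR).symm.trans (H.right_top hR e))
  | @tail y z hy hyz ih =>
    intro e
    obtain ⟨Py, Pz, hS⟩ := L.swap _ _ hyz.1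
    have e' := (H.right_second hS e).resolve_left (ih Py)
    have := H.left_top hS.top_right e'
    exact hS.ne ((hyz.2.2 Pz Py hS.top_right hS.top_left).symm.trans this)

/-- Otherwise the edge is oriented in the sense of `not_option`. Absence of leaves lets every
oriented edge be continued, so finiteness produces an oriented cycle, whose vertices would exclude
themselves, against unanimity on `C`. -/
theorem first_symm (L : LeaflessCore D C E) (H : TwoSP h)
    (hu : ∀ P : D, P.1.top ∈ C → h P P = P.1.top) {a b : X} (hab : E a b)
    (h1 : FirstWins h a b) : FirstWins h b a := by
  refine (L.first_or_second H hu (L.symm _ _ hab)).resolve_right fun h2 => ?_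
  let O : X → X → Prop := fun b c => E b c ∧ FirstWins h b c ∧ SecondWins h c b
  have next : ∀ b c, O b c → ∃ d, O c d := by
    rintro b c ⟨hbc, h1, h2⟩
    obtain ⟨d, hdb, hcd⟩ := L.no_leaf b c hbc
    refine ⟨d, hcd, L.first_step H hu hbc hcd hdb.symm h1, ?_⟩
    refine (L.first_or_second H hu (L.symm _ _ hcd)).resolve_left fun h3 => ?_
    exact L.not_both (L.ne hbc).symm
      (L.first_step H hu (L.symm _ _ hcd) (L.symm _ _ hbc) hdb h3) h2
  have irr : ∀ x ∈ C, ¬ Relation.TransGen O x x := by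
    intro x hx hxx
    obtain ⟨P, hP⟩ := L.rich x
    exact L.not_option H hxx hP P ((hu P (hP ▸ hx)).trans hP)
  -- Without cycles, `T` is well-founded, but a minimal vertex with an outgoing edge has a successor
  -- of the same kind.
  let T : X → X → Prop := fun x y => x ∈ C ∧ y ∈ C ∧ Relation.TransGen O y x
  have : IsTrans X T := ⟨fun x y z hxy hyz => ⟨hxy.1, hyz.2.1, hyz.2.2.trans hxy.2.2⟩⟩
  have : Std.Irrefl T := ⟨fun x hx => irr x hx.1 hx.2.2⟩
  obtain ⟨x, ⟨hxC, y, hxy⟩, hmin⟩ := (Finite.wellFounded_of_trans_of_irrefl T).has_min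
    {x | x ∈ C ∧ ∃ y, O x y} ⟨a, L.mem _ _ (L.symm _ _ hab), b, hab, h1, h2⟩
  have hyC := L.mem _ _ hxy.1
  exact hmin y ⟨hyC, next x y hxy⟩ ⟨hyC, hxC, .single hxy⟩

/-- What voter 1 can obtain against `Q` spreads along edges: a voter with `z` first and `y` second
gets one of them, and getting `y` would contradict the win at `(z, y)`. -/
theorem dictator_of_first (L : LeaflessCore D C E) (H : TwoSP h)
    (h1 : ∀ a b, E a b → FirstWins h a b) {c : X} (hcC : c ∈ C) (Q : D) {R : D} (hc : h R Q = c)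
    (P : D) (hP : P.1.top ∈ C) : h P Q = P.1.top := by
  have key : ∀ z, Relation.ReflTransGen E c z → ∃ R, h R Q = z := by
    intro z hz
    induction hz with
    | refl => exact ⟨R, hc⟩
    | @tail y z _ hyz ih =>
      obtain ⟨R, hR⟩ := ih
      obtain ⟨Py, Pz, hS⟩ := L.swap _ _ hyz
      refine ⟨Pz, (H.left_second hS.symm hR).resolve_right fun e => ?_⟩
      have := H.right_top (Q := Py) hS.top_left e
      exact hS.ne (this.symm.trans (h1 _ _ (L.symm _ _ hyz) Pz Py hS.top_right hS.top_left))
  obtain ⟨R, hR⟩ := key _ (L.connected c hcC _ hP)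
  exact H.left_top rfl hR

theorem first_all_or_second_all (L : LeaflessCore D C E) (H : TwoSP h)
    (hu : ∀ P : D, P.1.top ∈ C → h P P = P.1.top) :
    (∀ a b, E a b → FirstWins h a b) ∨ ∀ a b, E a b → SecondWins h a b := by
  by_contra! hne
  obtain ⟨⟨a, b, hab, h2⟩, ⟨c, d, hcd, h1⟩⟩ := hne
  have h1' := (L.first_or_second H hu hcd).resolve_right h1
  have key : ∀ z, Relation.ReflTransGen E d z → ∀ w, E z w → FirstWins h z w := by
    have start : ∀ x y, E x y → FirstWins h x y → ∀ w, E y w → FirstWins h y w := by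
      intro x y hxy hx w hyw
      by_cases e : x = w
      · subst e
        exact L.first_symm H hu hxy hx
      · exact L.first_step H hu hxy hyw e hx
    intro z hz
    induction hz with
    | refl => exact start c d hcd h1'
    | tail _ hyz ih => exact start _ _ hyz (ih _ hyz)
  exact h2 (key a (L.connected d (L.mem _ _ hcd) a (L.mem _ _ (L.symm _ _ hab))) b hab)

end LeaflessCore

/-! ### Hybrid domains over a line and cuts for two voters -/

/-- A hybrid domain over a linear order with thresholds `lo ≤ hi`: preferences are single-peaked
outside the open interval between the thresholds, consecutive alternatives outside of it are
connected by a swap, and so are, without leaves, the alternatives from `lo` to `hi`. -/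
structure HybridDomain {X : Type*} [Finite X] [Nonempty X] [LinearOrder X] (D : Set (Pref X))
    (lo hi : X) (E : X → X → Prop) : Prop where
  le : lo ≤ hi
  rich : ∀ a, ∃ P : D, P.1.top = a
  rel : ∀ P : D, ∀ a b, a ∈ intBetween P.1.top b → ¬ (lo < a ∧ a < hi) → P.1.rel a b
  swap : ∀ a b, a ⋖ b → b ≤ lo ∨ hi ≤ a → ∃ P Q : D, SwapPair P.1 Q.1 a b
  core : lo < hi → LeaflessCore D (Set.Icc lo hi) E

namespace HybridDomain

variable {X : Type*} [Finite X] [Nonempty X] [LinearOrder X] {D : Set (Pref X)} {lo hi : X}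
  {E : X → X → Prop}

theorem rel_of_gt (K : HybridDomain D lo hi E) (P : D) {z w : X} (hzw : w < z) (hz : z ≤ P.1.top)
    (ho : ¬ (lo < z ∧ z < hi)) : P.1.rel z w := by
  rcases hz.eq_or_lt with e | hlt
  · rw [e]; exact P.1.rel_top (e ▸ hzw.ne)
  · exact K.rel P z w (Or.inr ⟨hzw, hlt⟩) ho

theorem rel_of_lt (K : HybridDomain D lo hi E) (P : D) {z w : X} (hzw : z < w) (hz : P.1.top ≤ z)
    (ho : ¬ (lo < z ∧ z < hi)) : P.1.rel z w := by
  rcases hz.eq_or_lt with e | hlt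
  · rw [← e]; exact P.1.rel_top (e ▸ hzw.ne')
  · exact K.rel P z w (Or.inl ⟨hlt, hzw⟩) ho

end HybridDomain

/-- If voter 1 wins at the edges, `P` would gain by claiming peak `g`; so voter 2 wins, and obtains
anything in `C` as soon as something in `C` is attainable against `P`. -/
theorem LeaflessCore.exists_option {X : Type*} [Finite X] [Nonempty X] {D : Set (Pref X)}
    {h : D → D → X} {C : Set X} {E : X → X → Prop} (L : LeaflessCore D C E) (H : TwoSP h)
    (hu : ∀ P : D, P.1.top ∈ C → h P P = P.1.top) {P Q : D} {u g : X} (huC : u ∈ C) (hgC : g ∈ C)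
    (hPQ : h P Q = u) (hrel : P.1.rel g u) : ∃ R, h P R = g := by
  obtain ⟨U, hU⟩ := L.rich u
  obtain ⟨G, hG⟩ := L.rich g
  rcases L.first_all_or_second_all H hu with h1 | h2
  · have e1 : h P U = u := H.right_top hU hPQ
    have e2 : h G U = g := by
      rw [← hG]
      exact L.dictator_of_first H h1 huC U ((hu U (hU ▸ huC)).trans hU) G (hG ▸ hgC)
    have := H.left P G U (by rw [e1, e2]; exact (P.1.ne_of_rel hrel).symm)
    rw [e1, e2] at this
    exact absurd hrel (P.1.asymm this)
  · refine ⟨G, ?_⟩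
    rw [← hG]
    exact L.dictator_of_first H.flip (fun a b hab Q R hQ hR => h2 b a (L.symm _ _ hab) R Q hR hQ)
      huC P hPQ G (hG ▸ hgC)

/-- A strategy-proof two-voter function whose diagonal is a function of the common peak that
behaves like a fixed ballot rule in one variable. -/
structure DiagonalHybrid {X : Type*} [Finite X] [Nonempty X] [LinearOrder X] {D : Set (Pref X)}
    (lo hi : X) (h : D → D → X) : Prop extends TwoSP h where
  cut : ∀ a b, a ⋖ b → b ≤ lo ∨ hi ≤ a → ∀ Q Q' : D, (b ≤ Q.1.top ↔ b ≤ Q'.1.top) →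
    (b ≤ h Q Q ↔ b ≤ h Q' Q')
  core : lo < hi → ∀ P P', h P P < hi → lo < h P' P' → h P P ≠ h P' P' →
    ∀ Q : D, Q.1.top ∈ Set.Icc lo hi → h Q Q = Q.1.top

namespace DiagonalHybrid

variable {X : Type*} [Finite X] [Nonempty X] [LinearOrder X] {D : Set (Pref X)} {lo hi : X}
  {E : X → X → Prop} {h : D → D → X}

theorem flip (H : DiagonalHybrid lo hi h) : DiagonalHybrid lo hi (fun P Q => h Q P) :=
  ⟨H.toTwoSP.flip, H.cut, H.core⟩

theorem diag_eq (H : DiagonalHybrid lo hi h) {P Q R : D} {x : X} (hPQ : h P Q = x)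
    (hR : R.1.top = x) : h R R = x :=
  H.left_top hR (H.right_top hR hPQ)

/-- The diagonal outcomes at peaks `a` and `b` lie on different sides of the cut, and two successive
swaps lead from one to the other; the outcome can move only from `a` to `b`. -/
theorem diag_ends (K : HybridDomain D lo hi E) (H : DiagonalHybrid lo hi h) {a b : X} (hab : a ⋖ b)
    (ho : b ≤ lo ∨ hi ≤ a) {P Q : D} (hP : h P P ≤ a) (hQ : b ≤ h Q Q) :
    (∀ R : D, R.1.top = a → h R R = a) ∧ ∀ R : D, R.1.top = b → h R R = b := by
  obtain ⟨A, B, hS⟩ := K.swap a b hab ho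
  have hA : h A A < b := by
    obtain ⟨R, hR⟩ := K.rich (h P P)
    have e := H.diag_eq (P := P) (Q := P) rfl hR
    have := H.cut a b hab ho A R (by
      rw [hS.top_left, hR]
      exact iff_of_false hab.lt.not_ge (hP.trans_lt hab.lt).not_ge)
    rw [e] at this
    exact lt_of_not_ge fun h' => (hP.trans_lt hab.lt).not_ge (this.1 h')
  have hB : b ≤ h B B := by
    obtain ⟨R, hR⟩ := K.rich (h Q Q)
    have e := H.diag_eq (P := Q) (Q := Q) rfl hR
    have := H.cut a b hab ho B R (by
      rw [hS.top_right, hR]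
      exact iff_of_true le_rfl hQ)
    rw [e] at this
    exact this.2 hQ
  have key : h A A = a ∧ h B B = b := by
    rcases H.left_swap (Q := A) hS with e | ⟨e1, e2⟩ <;>
    rcases H.right_swap (P := B) hS with e' | ⟨e1', e2'⟩
    · rw [e', e] at hB
      exact absurd hB hA.not_ge
    · exact ⟨e ▸ e1', e2'⟩
    · exact ⟨e1, e'.trans e2⟩
    · exact absurd (e2.symm.trans e1') hS.ne.symm
  exact ⟨fun R hR => H.diag_eq key.1 hR, fun R hR => H.diag_eq key.2 hR⟩

/-- Let `u` be the largest option of voter 2 not above `a`, and suppose `u < a`. From within the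
threshold interval, `exists_option` yields the larger option `hi`. Elsewhere, a voter 2 with the
successor of `u` first and `u` second would get `u`, and voter 1 would profit from copying that
report. -/
theorem exists_option_lower (K : HybridDomain D lo hi E) (H : DiagonalHybrid lo hi h) {a b : X}
    (hab : a ⋖ b) (ho : b ≤ lo ∨ hi ≤ a) {P : D} (hP : b ≤ P.1.top) {R : D} (hR : b ≤ h R R)
    {Q : D} (hQ : h P Q ≤ a) : ∃ Q', h P Q' = a := by
  obtain ⟨u, ⟨⟨hua, Qu, hQu⟩, hmax⟩⟩ := (Set.toFinite {u | u ≤ a ∧ ∃ Q', h P Q' = u}).exists_maximal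
    ⟨h P Q, hQ, Q, rfl⟩
  have hmax' : ∀ v, v ≤ a → u < v → ∀ Q', h P Q' ≠ v := fun v hv huv Q' e =>
    (hmax ⟨hv, Q', e⟩ huv.le).not_gt huv
  obtain ⟨U, hU⟩ := K.rich u
  have hUU : h U U = u := H.diag_eq hQu hU
  rcases hua.eq_or_lt with rfl | hlt
  · exact ⟨Qu, hQu⟩
  exfalso
  by_cases hc : lo ≤ u ∧ u < hi
  · have hia : hi ≤ a := ho.resolve_left fun h' =>
      (hc.1.trans_lt (hlt.trans hab.lt)).not_ge h'
    have hlh : lo < hi := hc.1.trans_lt hc.2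
    have hlR : hi < h R R := (hia.trans_lt hab.lt).trans_le hR
    obtain ⟨Q', e⟩ := (K.core hlh).exists_option H.toTwoSP
      (H.core hlh U R (hUU.trans_lt hc.2) (hlh.trans hlR) (hUU.trans_lt (hc.2.trans hlR)).ne)
      ⟨hc.1, hc.2.le⟩ ⟨hlh.le, le_rfl⟩ hQu
      (K.rel_of_gt P hc.2 (hia.trans (hab.le.trans hP)) fun h' => lt_irrefl _ h'.2)
    exact hmax' hi hia hc.2 Q' e
  · obtain ⟨u', huu', hu'a⟩ := exists_covBy_le_of_lt hlt
    have ho' : u' ≤ lo ∨ hi ≤ u := by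
      by_cases h' : lo ≤ u
      · exact Or.inr (le_of_not_gt fun h'' => hc ⟨h', h''⟩)
      · exact Or.inl (huu'.ge_of_gt (lt_of_not_ge h'))
    obtain ⟨A, B, hS⟩ := K.swap u u' huu' ho'
    rcases H.right_second hS.symm hQu with e | e
    · exact hmax' u' hu'a huu'.lt _ e
    · have e' := (diag_ends K H huu' ho' (P := U) (Q := R) hUU.le
        (hu'a.trans (hab.le.trans hR))).2 B hS.top_right
      have h1 := H.left P B B (by rw [e, e']; exact huu'.lt.ne)
      rw [e, e'] at h1
      refine P.1.asymm h1 (K.rel_of_gt P huu'.lt (hu'a.trans (hab.le.trans hP)) fun h' => ?_)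
      rcases ho' with h'' | h''
      · exact h''.not_gt h'.1
      · exact (h''.trans_lt huu'.lt).not_gt h'.2

theorem exists_option_upper (K : HybridDomain D lo hi E) (H : DiagonalHybrid lo hi h) {a b : X}
    (hab : a ⋖ b) (ho : b ≤ lo ∨ hi ≤ a) {P : D} (hP : P.1.top ≤ a) {R : D} (hR : h R R ≤ a)
    {Q : D} (hQ : b ≤ h P Q) : ∃ Q', h P Q' = b := by
  obtain ⟨u, ⟨⟨hub, Qu, hQu⟩, hmin⟩⟩ := (Set.toFinite {u | b ≤ u ∧ ∃ Q', h P Q' = u}).exists_minimal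
    ⟨h P Q, hQ, Q, rfl⟩
  have hmin' : ∀ v, b ≤ v → v < u → ∀ Q', h P Q' ≠ v := fun v hv hvu Q' e =>
    (hmin ⟨hv, Q', e⟩ hvu.le).not_gt hvu
  obtain ⟨U, hU⟩ := K.rich u
  have hUU : h U U = u := H.diag_eq hQu hU
  rcases hub.eq_or_lt with rfl | hlt
  · exact ⟨Qu, hQu⟩
  exfalso
  by_cases hc : lo < u ∧ u ≤ hi
  · have hbl : b ≤ lo := ho.resolve_right fun h' =>
      ((hab.lt.trans hlt).trans_le hc.2).not_ge h'
    have hlh : lo < hi := hc.1.trans_le hc.2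
    have hlR : h R R < lo := (hR.trans_lt hab.lt).trans_le hbl
    obtain ⟨Q', e⟩ := (K.core hlh).exists_option H.toTwoSP
      (H.core hlh R U (hlR.trans hlh) (hUU.symm ▸ hc.1) (hUU.symm ▸ (hlR.trans hc.1).ne))
      ⟨hc.1.le, hc.2⟩ ⟨le_rfl, hlh.le⟩ hQu
      (K.rel_of_lt P hc.1 (hP.trans (hab.le.trans hbl)) fun h' => lt_irrefl _ h'.1)
    exact hmin' lo hbl hc.1 Q' e
  · obtain ⟨u', hbu', huu'⟩ := exists_le_covBy_of_lt hlt
    have ho' : u ≤ lo ∨ hi ≤ u' := by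
      by_cases h' : u ≤ hi
      · exact Or.inl (le_of_not_gt fun h'' => hc ⟨h'', h'⟩)
      · exact Or.inr (huu'.le_of_lt (lt_of_not_ge h'))
    obtain ⟨A, B, hS⟩ := K.swap u' u huu' ho'
    rcases H.right_second hS hQu with e | e
    · exact hmin' u' hbu' huu'.lt _ e
    · have e' := (diag_ends K H huu' ho' (P := R) (Q := U) (hR.trans (hab.le.trans hbu'))
        hUU.ge).1 A hS.top_left
      have h1 := H.left P A A (by rw [e, e']; exact huu'.lt.ne')
      rw [e, e'] at h1
      refine P.1.asymm h1 (K.rel_of_lt P huu'.lt (hP.trans (hab.le.trans hbu')) fun h' => ?_)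
      rcases ho' with h'' | h''
      · exact (huu'.lt.trans_le h'').not_gt h'.1
      · exact h''.not_gt h'.2

/-- If the options of voter 2 meet both sides of a cut, then they contain both of its ends. -/
theorem options_ends (K : HybridDomain D lo hi E) (H : DiagonalHybrid lo hi h) {a b : X}
    (hab : a ⋖ b) (ho : b ≤ lo ∨ hi ≤ a) {P Q Q' : D} (hQ : b ≤ h P Q) (hQ' : h P Q' ≤ a) :
    (∃ R, h P R = a) ∧ ∃ R, h P R = b := by
  obtain ⟨U, hU⟩ := K.rich (h P Q)
  obtain ⟨V, hV⟩ := K.rich (h P Q')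
  have hUU : b ≤ h U U := hQ.trans_eq (H.diag_eq rfl hU).symm
  have hVV : h V V ≤ a := (H.diag_eq rfl hV).trans_le hQ'
  have ends := diag_ends K H hab ho hVV hUU
  obtain ⟨A, B, hS⟩ := K.swap a b hab ho
  have hoa : ¬ (lo < a ∧ a < hi) := fun h' =>
    ho.elim (fun e => (hab.lt.trans_le e).not_gt h'.1) fun e => e.not_gt h'.2
  have hob : ¬ (lo < b ∧ b < hi) := fun h' =>
    ho.elim (fun e => e.not_gt h'.1) fun e => (e.trans_lt hab.lt).not_gt h'.2
  rcases le_or_gt b P.1.top with hP | hP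
  · obtain ⟨R, hR⟩ := exists_option_lower K H hab ho hP hUU hQ'
    refine ⟨⟨R, hR⟩, B, (H.right_second hS.symm hR).resolve_right fun e => ?_⟩
    have h1 := H.left P B B (by rw [e, ends.2 B hS.top_right]; exact hS.ne)
    rw [e, ends.2 B hS.top_right] at h1
    exact P.1.asymm h1 (K.rel_of_gt P hab.lt hP hob)
  · have hP := hab.le_of_lt hP
    obtain ⟨R, hR⟩ := exists_option_upper K H hab ho hP hVV hQ
    refine ⟨⟨A, (H.right_second hS hR).resolve_right fun e => ?_⟩, R, hR⟩
    have h1 := H.left P A A (by rw [e, ends.1 A hS.top_left]; exact hS.ne.symm)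
    rw [e, ends.1 A hS.top_left] at h1
    exact P.1.asymm h1 (K.rel_of_lt P hab.lt hP hoa)

/-- If voter 2 can influence the side, both ends of the cut are available, and each end beats the
whole opposite side for a voter whose peak is on its own side. -/
theorem cut_right (K : HybridDomain D lo hi E) (H : DiagonalHybrid lo hi h) {a b : X}
    (hab : a ⋖ b) (ho : b ≤ lo ∨ hi ≤ a) (P : D) {Q Q' : D} (hQ : b ≤ Q.1.top ↔ b ≤ Q'.1.top) :
    b ≤ h P Q ↔ b ≤ h P Q' := by
  have key : ∀ Q Q' : D, (b ≤ Q.1.top ↔ b ≤ Q'.1.top) → b ≤ h P Q → b ≤ h P Q' := by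
    intro Q Q' hQQ' hQ
    by_contra hlt
    rw [not_le] at hlt
    have hQ' : h P Q' ≤ a := hab.le_of_lt hlt
    obtain ⟨⟨R, hR⟩, ⟨R', hR'⟩⟩ := options_ends K H hab ho hQ hQ'
    have hoa : ¬ (lo < a ∧ a < hi) := fun h' =>
      ho.elim (fun e => (hab.lt.trans_le e).not_gt h'.1) fun e => e.not_gt h'.2
    have hob : ¬ (lo < b ∧ b < hi) := fun h' =>
      ho.elim (fun e => e.not_gt h'.1) fun e => (e.trans_lt hab.lt).not_gt h'.2
    rcases le_or_gt b Q.1.top with ht | ht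
    · have h1 := H.right P Q' R' (by rw [hR']; exact hlt.ne)
      rw [hR'] at h1
      exact Q'.1.asymm h1 (K.rel_of_gt Q' hlt (hQQ'.1 ht) hob)
    · have h1 := H.right P Q R (by rw [hR]; exact (hab.lt.trans_le hQ).ne')
      rw [hR] at h1
      exact Q.1.asymm h1 (K.rel_of_lt Q (hab.lt.trans_le hQ) (hab.le_of_lt ht) hoa)
  exact ⟨key Q Q' hQ, key Q' Q hQ.symm⟩

end DiagonalHybrid

namespace DiagonalHybrid

variable {X : Type*} [Finite X] [Nonempty X] [LinearOrder X] {D : Set (Pref X)} {lo hi : X}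
  {E : X → X → Prop} {h : D → D → X}

/-- Only peaks of voter 2 outside the interval are new. It suffices that voter 1 obtains the
threshold nearest to that peak: an outcome beyond it would, by the cut property, give voter 2 power
over that cut even when voter 1 has the other threshold as peak. -/
theorem first_dictator (K : HybridDomain D lo hi E) (H : DiagonalHybrid lo hi h) (hlh : lo < hi)
    (hu : ∀ P : D, P.1.top ∈ Set.Icc lo hi → h P P = P.1.top)
    (h1 : ∀ a b, E a b → FirstWins h a b) (P Q : D) (hP : P.1.top ∈ Set.Icc lo hi) :
    h P Q = P.1.top := by
  have L := K.core hlh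
  have inside : ∀ P Q : D, P.1.top ∈ Set.Icc lo hi → Q.1.top ∈ Set.Icc lo hi →
      h P Q = P.1.top := fun P Q hP hQ =>
    L.dictator_of_first H.toTwoSP h1 hQ Q (hu Q hQ) P hP
  obtain ⟨A, hA⟩ := K.rich lo
  obtain ⟨B, hB⟩ := K.rich hi
  have hAC : A.1.top ∈ Set.Icc lo hi := by rw [hA]; exact ⟨le_rfl, hlh.le⟩
  have hBC : B.1.top ∈ Set.Icc lo hi := by rw [hB]; exact ⟨hlh.le, le_rfl⟩
  have hAB : h A B = lo := (inside A B hAC hBC).trans hA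
  have hBA : h B A = hi := (inside B A hBC hAC).trans hB
  by_cases hQ : Q.1.top ∈ Set.Icc lo hi
  · exact inside P Q hP hQ
  rcases lt_or_ge Q.1.top lo with hlt | hge
  · refine L.dictator_of_first H.toTwoSP h1 (c := lo) ⟨le_rfl, hlh.le⟩ Q (R := A) ?_ P hP
    by_contra hne
    have hle : h A Q < lo := by
      refine lt_of_le_of_ne (le_of_not_gt fun hgt => ?_) hne
      have e := (hu A hAC).trans hA
      have := H.right A Q A (by rwa [e])
      rw [e] at this
      exact Q.1.asymm this (K.rel_of_lt Q hgt hlt.le fun h' => lt_irrefl _ h'.1)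
    obtain ⟨a, hQa, hab⟩ := exists_le_covBy_of_lt hle
    have hcut := cut_right K H.flip hab (Or.inl le_rfl) Q (Q := A) (Q' := B)
      (iff_of_true hAC.1 hBC.1)
    obtain ⟨-, R, hR⟩ := options_ends K H hab (Or.inl le_rfl) (P := B) (Q := A) (Q' := Q)
      (hBA ▸ hlh.le) (hab.le_of_lt (lt_of_not_ge fun h' => hle.not_ge (hcut.2 h')))
    exact hlh.ne' (hBA.symm.trans (H.right_top hA hR))
  · have hgt : hi < Q.1.top := lt_of_not_ge fun h' => hQ ⟨hge, h'⟩
    refine L.dictator_of_first H.toTwoSP h1 (c := hi) ⟨hlh.le, le_rfl⟩ Q (R := B) ?_ P hP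
    by_contra hne
    have hle : hi < h B Q := by
      refine lt_of_le_of_ne (le_of_not_gt fun hgt' => ?_) (Ne.symm hne)
      have e := (hu B hBC).trans hB
      have := H.right B Q B (by rwa [e])
      rw [e] at this
      exact Q.1.asymm this (K.rel_of_gt Q hgt' hgt.le fun h' => lt_irrefl _ h'.2)
    obtain ⟨b, hab, hbQ⟩ := exists_covBy_le_of_lt hle
    have hcut := cut_right K H.flip hab (Or.inr le_rfl) Q (Q := A) (Q' := B)
      (iff_of_false (hAC.2.trans_lt hab.lt).not_ge (hBC.2.trans_lt hab.lt).not_ge)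
    obtain ⟨⟨R, hR⟩, -⟩ := options_ends K H hab (Or.inr le_rfl) (P := A) (Q := Q) (Q' := B)
      (hcut.2 hbQ) (hAB ▸ hlh.le)
    exact hlh.ne (hAB.symm.trans (H.right_top hB hR))

theorem first_or_second_dictator (K : HybridDomain D lo hi E) (H : DiagonalHybrid lo hi h)
    (hlh : lo < hi) (hu : ∀ P : D, P.1.top ∈ Set.Icc lo hi → h P P = P.1.top) :
    (∀ P Q : D, P.1.top ∈ Set.Icc lo hi → h P Q = P.1.top) ∨
      ∀ P Q : D, Q.1.top ∈ Set.Icc lo hi → h P Q = Q.1.top := by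
  have L := K.core hlh
  refine (L.first_all_or_second_all H.toTwoSP hu).imp (first_dictator K H hlh hu) fun h2 P Q => ?_
  exact first_dictator K H.flip hlh hu
    (fun a b hab R S hR hS => h2 b a (L.symm _ _ hab) S R hS hR) Q P

end DiagonalHybrid

theorem TwoSP.diag {X : Type*} {D : Set (Pref X)} {h : D → D → X} (H : TwoSP h) {P Q : D}
    (hne : h P P ≠ h Q Q) : P.1.rel (h P P) (h Q Q) := by
  by_cases e : h P P = h Q P
  · rw [e] at hne ⊢
    exact H.right Q P Q hne
  by_cases e' : h Q P = h Q Q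
  · rw [← e']
    exact H.left P Q P e
  · exact P.1.trans _ _ _ (H.left P Q P e) (H.right Q P Q e')

/-! ### Merging voters -/

open Function

/-- Strategy-proofness of a social choice function with an arbitrary set of voters. -/
def VotersSP {ι X : Type*} [DecidableEq ι] {D : Set (Pref X)} (f : (ι → D) → X) : Prop :=
  ∀ (i : ι) (P : ι → D) (Q : D), f P ≠ f (update P i Q) → (P i).1.rel (f P) (f (update P i Q))

/-- The voter `j` is merged into the voter `i`. -/
def mergedProfile {ι Y : Type*} [DecidableEq ι] {i j : ι} (hij : i ≠ j) (P : {k // k ≠ j} → Y) :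
    ι → Y :=
  fun k => if hk : k = j then P ⟨i, hij⟩ else P ⟨k, hk⟩

/-- Outside of the open interval from `lo` to `hi`, the outcome is determined by which voters have
their peaks beyond a given cut; some voter dictates from `lo` to `hi`. -/
structure CutDetermined {ι X : Type*} [Finite X] [Nonempty X] [LinearOrder X] {D : Set (Pref X)}
    (lo hi : X) (f : (ι → D) → X) : Prop where
  cut : ∀ a b, a ⋖ b → b ≤ lo ∨ hi ≤ a → ∀ P P' : ι → D,
    (∀ i, b ≤ (P i).1.top ↔ b ≤ (P' i).1.top) → (b ≤ f P ↔ b ≤ f P')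
  core : lo < hi → ∃ k, ∀ P : ι → D, (P k).1.top ∈ Set.Icc lo hi → f P = (P k).1.top

section Voters

theorem forall_profile_of_update {ι Y : Type*} [Fintype ι] [DecidableEq ι] {p : (ι → Y) → Prop}
    (hp : ∀ P i Q, p P → p (update P i Q)) {P : ι → Y} (hP : p P) (P' : ι → Y) : p P' := by
  have : ∀ s : Finset ι, p (s.piecewise P' P) := by
    intro s
    induction s using Finset.induction_on with
    | empty => simpa using hP
    | insert i s _ ih =>
      rw [Finset.piecewise_insert]
      exact hp _ _ _ ih
  simpa using this Finset.univ

variable {ι X : Type*} [DecidableEq ι] {D : Set (Pref X)} {f : (ι → D) → X}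

theorem VotersSP.twoSP (hf : VotersSP f) {i j : ι} (hij : i ≠ j) (P : ι → D) :
    TwoSP fun Q R => f (update (update P i Q) j R) where
  left Q Q' R hne := by
    have e : update (update P i Q') j R = update (update (update P i Q) j R) i Q' := by
      rw [update_comm hij.symm, update_idem]
    have := hf i (update (update P i Q) j R) Q'
    rw [← e] at this
    simpa [hij] using this hne
  right Q R R' hne := by
    have := hf j (update (update P i Q) j R) R'
    rw [update_idem] at this
    simpa using this hne

theorem mergedProfile_update_left {Y : Type*} {i j : ι} (hij : i ≠ j) (P : {k // k ≠ j} → Y)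
    (Q : Y) : mergedProfile hij (update P ⟨i, hij⟩ Q) =
      update (update (mergedProfile hij P) i Q) j Q := by
  funext k
  by_cases hk : k = j
  · subst hk; simp [mergedProfile]
  · by_cases hki : k = i
    · subst hki; simp [mergedProfile, hk]
    · simp [mergedProfile, hk, hki]

theorem mergedProfile_update_of_ne {Y : Type*} {i j : ι} (hij : i ≠ j) (P : {k // k ≠ j} → Y)
    (Q : Y) {k : {k // k ≠ j}} (hki : k ≠ ⟨i, hij⟩) : mergedProfile hij (update P k Q) =
      update (mergedProfile hij P) k Q := by
  funext l
  by_cases hl : l = j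
  · subst hl
    simp [mergedProfile, k.2.symm, hki.symm]
  · by_cases hlk : l = k
    · subst hlk; simp [mergedProfile, hl]
    · have : (⟨l, hl⟩ : {k // k ≠ j}) ≠ k := fun e => hlk (congrArg Subtype.val e)
      simp [mergedProfile, hl, hlk, this]

theorem VotersSP.merged (hf : VotersSP f) {i j : ι} (hij : i ≠ j) :
    VotersSP fun P => f (mergedProfile hij P) := by
  intro k P Q hne
  by_cases hki : k = ⟨i, hij⟩
  · subst hki
    have H := hf.twoSP hij (mergedProfile hij P)
    have e : mergedProfile hij P =
        update (update (mergedProfile hij P) i (P ⟨i, hij⟩)) j (P ⟨i, hij⟩) := by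
      rw [← mergedProfile_update_left, update_eq_self]
    have e' := mergedProfile_update_left hij P Q
    have := H.diag (P := P ⟨i, hij⟩) (Q := Q)
    simp only [← e, ← e'] at this
    exact this hne
  · have e := mergedProfile_update_of_ne hij P Q hki
    simp only [e] at hne ⊢
    have := hf k (mergedProfile hij P) Q hne
    simpa [mergedProfile, k.2] using this

/-- The restriction to the voters other than `j` of a profile in which `i` reports `Q`. -/
theorem mergedProfile_restrict {Y : Type*} {i j : ι} (hij : i ≠ j) (P : ι → Y) (Q : Y) :
    mergedProfile hij (fun k => update P i Q k) = update (update P i Q) j Q := by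
  funext k
  by_cases hk : k = j
  · subst hk; simp [mergedProfile]
  · simp [mergedProfile, hk]

variable [Finite X] [Nonempty X] [LinearOrder X] {lo hi : X} {E : X → X → Prop}

theorem le_low_of_dictator (K : HybridDomain D lo hi E) (hf : VotersSP f) {k : ι}
    (hk : ∀ P : ι → D, (P k).1.top ∈ Set.Icc lo hi → f P = (P k).1.top) (P : ι → D)
    (hP : (P k).1.top ≤ lo) : f P ≤ lo := by
  obtain ⟨A, hA⟩ := K.rich lo
  by_contra! hlt
  have e : f (update P k A) = lo := by
    rw [hk] <;> simp [hA, K.le]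
  have := hf k P A (by rw [e]; exact hlt.ne')
  rw [e] at this
  exact (P k).1.asymm this (K.rel_of_lt _ hlt hP fun h' => lt_irrefl _ h'.1)

theorem high_le_of_dictator (K : HybridDomain D lo hi E) (hf : VotersSP f) {k : ι}
    (hk : ∀ P : ι → D, (P k).1.top ∈ Set.Icc lo hi → f P = (P k).1.top) (P : ι → D)
    (hP : hi ≤ (P k).1.top) : hi ≤ f P := by
  obtain ⟨A, hA⟩ := K.rich hi
  by_contra! hlt
  have e : f (update P k A) = hi := by
    rw [hk] <;> simp [hA, K.le]
  have := hf k P A (by rw [e]; exact hlt.ne)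
  rw [e] at this
  exact (P k).1.asymm this (K.rel_of_gt _ hlt hP fun h' => lt_irrefl _ h'.2)

/-- If the dictator of the merged rule is a fixed voter, the diagonal stays weakly below `lo`, stays
weakly above `hi`, or is constant, so the premises of `core` fail. -/
theorem CutDetermined.diagonalHybrid (K : HybridDomain D lo hi E) (hf : VotersSP f) {i j : ι}
    (hij : i ≠ j) (hg : CutDetermined lo hi fun P => f (mergedProfile hij P)) (P : ι → D) :
    DiagonalHybrid lo hi fun Q R => f (update (update P i Q) j R) where
  toTwoSP := hf.twoSP hij P
  cut a b hab ho Q Q' hQ := by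
    have := hg.cut a b hab ho (fun k => update P i Q k) (fun k => update P i Q' k) (by
      intro k
      by_cases hk : (k : ι) = i
      · rw [hk]; simpa using hQ
      · simp [hk])
    simpa only [mergedProfile_restrict] using this
  core hlh Q Q' h1 h2 hne R hR := by
    obtain ⟨k, hk⟩ := hg.core hlh
    have hsp := hf.merged hij
    have e := fun S => mergedProfile_restrict hij P S
    simp only [← e] at h1 h2 hne ⊢
    by_cases hki : (k : ι) = i
    · have := hk (fun k => update P i R k) (by simpa [hki] using hR)
      simpa [hki] using this
    · exfalso
      rcases lt_or_ge (P k).1.top lo with hlt | hge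
      · exact h2.not_ge (le_low_of_dictator K hsp hk (fun k => update P i Q' k)
          (by simpa [hki] using hlt.le))
      rcases lt_or_ge hi (P k).1.top with hgt | hle
      · exact h1.not_ge (high_le_of_dictator K hsp hk (fun k => update P i Q k)
          (by simpa [hki] using hgt.le))
      · have h3 := hk (fun k => update P i Q k) (by simpa [hki] using ⟨hge, hle⟩)
        have h4 := hk (fun k => update P i Q' k) (by simpa [hki] using ⟨hge, hle⟩)
        simp only [update_of_ne hki] at h3 h4
        exact hne (h3.trans h4.symm)

variable [Fintype ι]

/-- If the merged voter dictates, then `i` or `j` does for each profile of the others, and `step`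
shows that the choice cannot depend on them. -/
theorem exists_core_dictator (K : HybridDomain D lo hi E) (hf : VotersSP f) {i j : ι}
    (hij : i ≠ j) (hg : CutDetermined lo hi fun P => f (mergedProfile hij P)) (hlh : lo < hi) :
    ∃ k, ∀ P : ι → D, (P k).1.top ∈ Set.Icc lo hi → f P = (P k).1.top := by
  obtain ⟨k, hk⟩ := hg.core hlh
  have self : ∀ P : ι → D, f (update (update P i (P i)) j (P j)) = f P := fun P => by simp
  by_cases hki : (k : ι) = i
  · have hki' : k = ⟨i, hij⟩ := Subtype.ext hki
    subst hki'
    have hu : ∀ (P : ι → D) (Q : D), Q.1.top ∈ Set.Icc lo hi →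
        f (update (update P i Q) j Q) = Q.1.top := by
      intro P Q hQ
      have := hk (fun k => update P i Q k) (by simpa using hQ)
      simpa [mergedProfile_restrict] using this
    have dict : ∀ P : ι → D,
        (∀ Q R : D, Q.1.top ∈ Set.Icc lo hi → f (update (update P i Q) j R) = Q.1.top) ∨
        ∀ Q R : D, R.1.top ∈ Set.Icc lo hi → f (update (update P i Q) j R) = R.1.top :=
      fun P => DiagonalHybrid.first_or_second_dictator K (hg.diagonalHybrid K hf hij P) hlh (hu P)
    obtain ⟨A, hA⟩ := K.rich lo
    obtain ⟨B, hB⟩ := K.rich hi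
    have hAC : A.1.top ∈ Set.Icc lo hi := by rw [hA]; exact ⟨le_rfl, hlh.le⟩
    have hBC : B.1.top ∈ Set.Icc lo hi := by rw [hB]; exact ⟨hlh.le, le_rfl⟩
    have step : ∀ (P : ι → D) (l : ι) (S : D),
        (∀ Q R : D, Q.1.top ∈ Set.Icc lo hi → f (update (update P i Q) j R) = Q.1.top) →
        ∀ Q R : D, Q.1.top ∈ Set.Icc lo hi →
          f (update (update (update P l S) i Q) j R) = Q.1.top := by
      intro P l S h1
      refine (dict (update P l S)).resolve_right fun h2 => ?_
      by_cases hli : l = i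
      · subst hli
        have e1 := h1 A B hAC
        have e2 := h2 A B hBC
        rw [update_idem] at e2
        exact hlh.ne (hA.symm.trans (e1.symm.trans (e2.trans hB)))
      by_cases hlj : l = j
      · subst hlj
        have e1 := h1 A B hAC
        have e2 := h2 A B hBC
        rw [update_comm (Ne.symm hij), update_idem] at e2
        exact hlh.ne (hA.symm.trans (e1.symm.trans (e2.trans hB)))
      -- A voter `l` able to pass the power from `i` to `j` would have to prefer the peak of `i` to
      -- that of `j`, whatever these two peaks are.
      · have rel : ∀ Q R : D, Q.1.top ∈ Set.Icc lo hi → R.1.top ∈ Set.Icc lo hi →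
            Q.1.top ≠ R.1.top → (P l).1.rel Q.1.top R.1.top := by
          intro Q R hQ hR hne
          have e1 := h1 Q R hQ
          have e2 := h2 Q R hR
          rw [update_comm hli, update_comm hlj] at e2
          have := hf l (update (update P i Q) j R) S (by rwa [e1, e2])
          rw [e1, e2] at this
          simpa [hli, hlj] using this
        refine (P l).1.asymm (rel A B hAC hBC ?_) (rel B A hBC hAC ?_)
        · rw [hA, hB]; exact hlh.ne
        · rw [hA, hB]; exact hlh.ne'
    rcases dict fun _ => A with h1 | h2
    · refine ⟨i, fun P hP => ?_⟩
      rw [← self P]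
      exact forall_profile_of_update
        (p := fun P => ∀ Q R : D, Q.1.top ∈ Set.Icc lo hi →
          f (update (update P i Q) j R) = Q.1.top) step h1 P _ _ hP
    · refine ⟨j, fun P hP => ?_⟩
      rw [← self P]
      refine (dict P).elim (fun h1 => ?_) (fun h2 => h2 _ _ hP)
      have e1 := forall_profile_of_update
        (p := fun P => ∀ Q R : D, Q.1.top ∈ Set.Icc lo hi →
          f (update (update P i Q) j R) = Q.1.top) step h1 (fun _ => A) A B hAC
      exact absurd (hA.symm.trans (e1.symm.trans ((h2 A B hBC).trans hB))) hlh.ne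
  · refine ⟨k, fun P hP => ?_⟩
    -- Moving the peaks of both `i` and `j` to the outcome preserves it, and the new profile comes
    -- from the merged rule.
    obtain ⟨R, hR⟩ := K.rich (f P)
    have e1 := (hg.diagonalHybrid K hf hij P).diag_eq (P := P i) (Q := P j) (self P) hR
    have e2 := hk (fun k => update P i R k) (by simpa [hki] using hP)
    simp only [mergedProfile_restrict, update_of_ne hki] at e2
    exact e1.symm.trans e2

theorem CutDetermined.of_merged [Nontrivial ι] (K : HybridDomain D lo hi E) (hf : VotersSP f)
    (hg : ∀ (i j : ι) (hij : i ≠ j), CutDetermined lo hi fun P => f (mergedProfile hij P)) :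
    CutDetermined lo hi f where
  cut a b hab ho P P' hP := by
    have step : ∀ (P : ι → D) (j : ι) (Q : D), (b ≤ (P j).1.top ↔ b ≤ Q.1.top) →
        (b ≤ f P ↔ b ≤ f (update P j Q)) := by
      intro P j Q hQ
      obtain ⟨i, hij⟩ := exists_ne j
      have := DiagonalHybrid.cut_right K ((hg i j hij).diagonalHybrid K hf hij P) hab ho (P i)
        (Q := P j) (Q' := Q) hQ
      simpa using this
    have : ∀ s : Finset ι, b ≤ f P ↔ b ≤ f (s.piecewise P' P) := by
      intro s
      induction s using Finset.induction_on with
      | empty => simp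
      | insert i s his ih =>
        rw [Finset.piecewise_insert, ih]
        refine step _ _ _ ?_
        rw [Finset.piecewise_eq_of_notMem _ _ _ his]
        exact hP i
    simpa using this Finset.univ
  core hlh := by
    obtain ⟨i, j, hij⟩ := exists_pair_ne ι
    exact exists_core_dictator K hf hij (hg i j hij) hlh

end Voters

theorem VotersSP.cutDetermined {X : Type*} [Finite X] [Nonempty X] [LinearOrder X]
    {D : Set (Pref X)} {lo hi : X} {E : X → X → Prop} (K : HybridDomain D lo hi E) (n : ℕ)
    {ι : Type*} [Fintype ι] [DecidableEq ι] (hι : Fintype.card ι = n + 1) {f : (ι → D) → X}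
    (hf : VotersSP f)
    (hu : ∀ (a : X) (P : ι → D), (∀ i, (P i).1.top = a) → f P = a) : CutDetermined lo hi f := by
  induction n generalizing ι with
  | zero =>
    obtain ⟨i, hi'⟩ := Fintype.card_eq_one_iff.1 hι
    have e : ∀ P : ι → D, f P = (P i).1.top := fun P => hu _ P fun k => by rw [hi' k]
    exact ⟨fun a b _ _ P P' hP => by rw [e, e]; exact hP i, fun _ => ⟨i, fun P _ => e P⟩⟩
  | succ n ih =>
    have : Nontrivial ι := Fintype.one_lt_card_iff_nontrivial.1 (by omega)
    refine .of_merged K hf fun i j hij => ih (ι := {k // k ≠ j}) ?_ (hf.merged hij) fun a P hP => ?_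
    · simp [Fintype.card_subtype_compl, hι]
    · refine hu a _ fun k => ?_
      unfold mergedProfile
      split <;> exact hP _

/-! ### From cuts to ballots -/

section Ballots

variable {X : Type*} [LinearOrder X] {n : ℕ} {b : Finset (Fin n) → X}

theorem FixedBallots.monotone (hb : FixedBallots b) : Monotone b := by
  intro J J' hJ
  rcases hJ.eq_or_ssubset with rfl | h
  · exact le_rfl
  · exact hb.mono _ _ h

theorem FixedBallots.le_ballotOutcome_iff (hb : FixedBallots b) {t : Fin n → X} {c : X} :
    c ≤ ballotOutcome b t ↔ c ≤ b {i | c ≤ t i} := by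
  simp only [ballotOutcome, Finset.le_sup'_iff, Finset.le_min'_iff, Finset.mem_univ, true_and,
    Finset.mem_insert, Finset.mem_image, forall_eq_or_imp, forall_exists_index, and_imp,
    forall_apply_eq_imp_iff₂]
  constructor
  · rintro ⟨J, hJ, ht⟩
    exact hJ.trans (hb.monotone fun i hi => by simpa using ht i hi)
  · exact fun h => ⟨_, h, fun i hi => by simpa using hi⟩

variable [Finite X] [Nonempty X] {D : Set (Pref X)} {lo hi : X} {E : X → X → Prop}
  {f : (Fin n → D) → X}

theorem FixedBallots.strategyProofRule (K : HybridDomain D lo hi E) (hb : FixedBallots b)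
    (hcd : lo < hi → ConstrainedDictatorship lo hi b)
    (hf : ∀ P, f P = ballotOutcome b fun i => (P i).1.top) : StrategyProofRule f := by
  have le_iff : ∀ P c, c ≤ f P ↔ c ≤ b {i | c ≤ (P i).1.top} := fun P c => by
    rw [hf, hb.le_ballotOutcome_iff]
  constructor
  · intro a P hP
    refine eq_of_forall_le_iff fun c => ?_
    rw [le_iff]
    by_cases hc : c ≤ a
    · simp [hP, hc, hb.univ c]
    · simpa [hP, hc] using (hb.empty a).trans_lt (lt_of_not_ge hc)
  · intro i P Q hne
    set P' := Function.update P i Q with hP'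
    have hother : ∀ k, k ≠ i → P' k = P k := fun k hk => by simp [hP', hk]
    rcases lt_trichotomy (P i).1.top (f P) with ht | ht | ht
    · have hle : f P ≤ f P' := by
        rw [le_iff]
        refine ((le_iff P _).1 le_rfl).trans (hb.monotone fun k hk => ?_)
        have hk' : f P ≤ (P k).1.top := by simpa using hk
        have : k ≠ i := by rintro rfl; exact hk'.not_gt ht
        simpa [hother k this] using hk'
      have hlt := lt_of_le_of_ne hle hne
      refine K.rel_of_lt (P i) hlt ht.le fun hc => ?_
      obtain ⟨k, hk⟩ := hcd (hc.1.trans hc.2)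
      have hkP : f P ≤ (P k).1.top := by
        by_contra h'
        refine hc.1.not_ge (((le_iff P _).1 le_rfl).trans ((hk _).2 ?_))
        simpa using h'
      have hki : k ≠ i := by rintro rfl; exact hkP.not_gt ht
      have hkP' : f P' ≤ (P k).1.top := by
        by_contra h'
        refine (hc.1.trans hlt).not_ge (((le_iff P' _).1 le_rfl).trans ((hk _).2 ?_))
        simpa [hother k hki] using h'
      -- The ballot dictator `k` has a peak at or above this level, so every coalition reaching it
      -- has a ballot at least `hi`.
      have : min (f P') hi ≤ f P := by
        rw [le_iff]
        refine (min_le_right _ _).trans ((hk _).1 ?_)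
        simp [hkP']
      exact (lt_min hlt hc.2).not_ge this
    · rw [← ht] at hne ⊢
      exact (P i).1.rel_top (Ne.symm hne)
    · have hle : f P' ≤ f P := by
        by_contra hlt
        rw [not_le] at hlt
        refine (lt_min hlt ht).not_ge ?_
        rw [le_iff]
        refine ((le_iff P' _).1 (min_le_left _ _)).trans (hb.monotone fun k hk => ?_)
        by_cases hki : k = i
        · subst hki; simp
        · simpa [hother k hki] using hk
      have hlt := lt_of_le_of_ne hle (Ne.symm hne)
      refine K.rel_of_gt (P i) hlt ht.le fun hc => ?_
      obtain ⟨k, hk⟩ := hcd (hc.1.trans hc.2)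
      have hkP : f P ≤ (P k).1.top := by
        by_contra h'
        refine hc.1.not_ge (((le_iff P _).1 le_rfl).trans ((hk _).2 ?_))
        simpa using h'
      by_cases hki : k = i
      · subst hki
        refine (lt_min ht hc.2).not_ge ?_
        rw [le_iff]
        refine (min_le_right _ _).trans ((hk _).1 ?_)
        simp
      · refine hlt.not_ge ?_
        rw [le_iff]
        refine hc.2.le.trans ((hk _).1 ?_)
        simpa [hother k hki] using hkP

/-- The ballot of `J` is the outcome when `J` reports the maximum and all others the minimum. At
each level, `P` may be replaced by such an extreme profile. -/
theorem StrategyProofRule.exists_ballots (K : HybridDomain D lo hi E) (hn : n ≠ 0)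
    (hf : StrategyProofRule f) : ∃ b : Finset (Fin n) → X, FixedBallots b ∧
      (lo < hi → ConstrainedDictatorship lo hi b) ∧
      ∀ P, f P = ballotOutcome b fun i => (P i).1.top := by
  obtain ⟨hu, hsp⟩ := hf
  have hsp : VotersSP f := hsp
  obtain ⟨m, rfl⟩ := Nat.exists_eq_succ_of_ne_zero hn
  have hcut : CutDetermined lo hi f := hsp.cutDetermined K m (Fintype.card_fin _) hu
  obtain ⟨mx, hmx⟩ := Finite.exists_max (id : X → X)
  obtain ⟨mn, hmn⟩ := Finite.exists_min (id : X → X)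
  simp only [id] at hmx hmn
  obtain ⟨Pmx, hPmx⟩ := K.rich mx
  obtain ⟨Pmn, hPmn⟩ := K.rich mn
  let p : Finset (Fin (m + 1)) → Fin (m + 1) → D := fun J i => if i ∈ J then Pmx else Pmn
  let b : Finset (Fin (m + 1)) → X := fun J => f (p J)
  have hcd : lo < hi → ∃ k, (∀ P, (P k).1.top ∈ Set.Icc lo hi → f P = (P k).1.top) ∧
      ∀ J : Finset (Fin (m + 1)), (k ∈ J → hi ≤ b J) ∧ (k ∉ J → b J ≤ lo) := by
    intro hlh
    obtain ⟨k, hk⟩ := hcut.core hlh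
    refine ⟨k, hk, fun J => ⟨fun hJ => ?_, fun hJ => ?_⟩⟩
    · exact high_le_of_dictator K hsp hk _ (by simp [p, hJ, hPmx, hmx])
    · exact le_low_of_dictator K hsp hk _ (by simp [p, hJ, hPmn, hmn])
  have key : ∀ P c, c ≤ f P ↔ c ≤ b {i | c ≤ (P i).1.top} := by
    intro P c
    rcases (hmn c).eq_or_lt with rfl | hlt
    · exact iff_of_true (hmn _) (hmn _)
    obtain ⟨a, -, hac⟩ := exists_le_covBy_of_lt hlt
    by_cases ho : c ≤ lo ∨ hi ≤ a
    · refine hcut.cut a c hac ho _ _ fun i => ?_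
      by_cases hi' : c ≤ (P i).1.top
      · simp [p, hi', hPmx, hmx]
      · simpa [p, hi', hPmn] using hlt
    -- The cut now lies within the threshold interval, and both sides of the equivalence are decided
    -- by the peak of the dictator alone.
    · push Not at ho
      have hc : c ≤ hi := hac.ge_of_gt ho.2
      obtain ⟨k, hk, hkb⟩ := hcd (ho.1.trans_le hc)
      by_cases hck : c ≤ (P k).1.top
      · refine iff_of_true ?_ (hc.trans ((hkb _).1 (by simpa using hck)))
        rcases le_total (P k).1.top hi with hle | hge
        · rwa [hk P ⟨ho.1.le.trans hck, hle⟩]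
        · exact hc.trans (high_le_of_dictator K hsp hk P hge)
      · refine iff_of_false ?_
          (((hkb _).2 (by simpa using hck)).trans_lt ho.1).not_ge
        rw [not_le] at hck ⊢
        rcases le_total (P k).1.top lo with hle | hge
        · exact (le_low_of_dictator K hsp hk P hle).trans_lt ho.1
        · rwa [hk P ⟨hge, hck.le.trans hc⟩]
  have step : ∀ (J : Finset (Fin (m + 1))) (i : Fin (m + 1)), i ∉ J → b J ≤ b (insert i J) := by
    intro J i hiJ
    by_contra! hlt
    have e : p (insert i J) = Function.update (p J) i Pmx := by
      funext k
      by_cases hk : k = i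
      · subst hk; simp [p]
      · simp [p, hk]
    have h1 := hsp i (p J) Pmx (by rw [← e]; exact hlt.ne')
    rw [← e] at h1
    have hpi : p J i = Pmn := by simp [p, hiJ]
    rw [hpi] at h1
    -- No ballot lies strictly between the thresholds, so a voter with minimal peak prefers the
    -- lower ballot and would join the coalition.
    refine Pmn.1.asymm h1 (K.rel_of_lt Pmn hlt (hPmn.trans_le (hmn _)) fun hc => ?_)
    obtain ⟨k, -, hk⟩ := hcd (hc.1.trans hc.2)
    by_cases hkJ : k ∈ insert i J
    · exact hc.2.not_ge ((hk _).1 hkJ)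
    · exact hc.1.not_ge ((hk _).2 hkJ)
  have mono : ∀ J s : Finset (Fin (m + 1)), b J ≤ b (J ∪ s) := by
    intro J s
    induction s using Finset.induction_on with
    | empty => simp
    | insert i s _ ih =>
      rw [Finset.union_insert]
      by_cases hi' : i ∈ J ∪ s
      · rwa [Finset.insert_eq_of_mem hi']
      · exact ih.trans (step _ _ hi')
  have hb : FixedBallots b := by
    refine ⟨fun x => ?_, fun x => ?_, fun J J' hJ => ?_⟩
    · exact (hu mn _ fun i => by simp [p, hPmn]).trans_le (hmn x)
    · exact (hmx x).trans_eq (hu mx _ fun i => by simp [p, hPmx]).symm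
    · have := mono J J'
      rwa [Finset.union_eq_right.2 hJ.1] at this
  refine ⟨b, hb, fun hlh => ?_, fun P => eq_of_forall_le_iff fun c => ?_⟩
  · obtain ⟨k, -, hk⟩ := hcd hlh
    exact ⟨k, hk⟩
  · rw [hb.le_ballotOutcome_iff, key]

end Ballots

theorem Pref.marginal_top {m : ℕ} {A : Fin m → Type*} [∀ s, Finite (A s)] [∀ s, Nonempty (A s)]
    (P : Pref (∀ s, A s)) (s : Fin m) : (P.marginal s).top = P.top s := by
  refine Pref.eq_top_of_forall _ fun b hb => ?_
  change P.rel (Function.update P.top s (P.top s)) (Function.update P.top s b)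
  rw [Function.update_eq_self]
  exact P.rel_top fun e => hb (by rw [← e]; simp)

/-! ### Marginal domains are hybrid -/

section CoreGraph

variable {X : Type*} [LinearOrder X] {G : SimpleGraph X} {lo hi : X}

/-- If no edge of a connected graph jumps over an alternative outside of the open interval from
`lo` to `hi`, then the graph is connected from `lo` to `hi`. -/
theorem reflTransGen_Icc_of_connected (hlh : lo ≤ hi) (hG : G.Connected)
    (hjump : ∀ u v c, G.Adj u v → u < c → c < v → lo < c ∧ c < hi) {a b : X}
    (ha : a ∈ Set.Icc lo hi) (hb : b ∈ Set.Icc lo hi) :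
    Relation.ReflTransGen
      (fun u v => u ∈ Set.Icc lo hi ∧ v ∈ Set.Icc lo hi ∧ G.Adj u v) a b := by
  -- Retraction onto the interval: each edge is either inside it or collapsed to a point, so a path
  -- projects to a path.
  let π : X → X := fun x => max lo (min hi x)
  have hπ : ∀ x, π x ∈ Set.Icc lo hi := fun x => ⟨le_max_left _ _, max_le hlh (min_le_left _ _)⟩
  have hπ_eq : ∀ x ∈ Set.Icc lo hi, π x = x := fun x hx => by simp [π, hx.1, hx.2]
  have hlow : ∀ x, x ≤ lo → π x = lo := fun x hx => by simp [π, hx, hx.trans hlh]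
  have hhigh : ∀ x, hi ≤ x → π x = hi := fun x hx => by simp [π, hx, hlh]
  have collapse : ∀ u v, G.Adj u v → u < v → π u = π v ∨ u ∈ Set.Icc lo hi ∧ v ∈ Set.Icc lo hi := by
    intro u v huv hlt
    rcases lt_or_ge u lo with hu | hu
    · left
      rw [hlow u hu.le, hlow v (le_of_not_gt fun h' => lt_irrefl _ (hjump u v lo huv hu h').1)]
    rcases lt_or_ge hi v with hv | hv
    · left
      rw [hhigh v hv.le, hhigh u (le_of_not_gt fun h' => lt_irrefl _ (hjump u v hi huv h' hv).2)]
    · exact Or.inr ⟨⟨hu, hlt.le.trans hv⟩, hu.trans hlt.le, hv⟩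
  have hab := (SimpleGraph.reachable_iff_reflTransGen a b).1 (hG.preconnected a b)
  rw [← hπ_eq a ha, ← hπ_eq b hb]
  generalize a = a' at hab
  clear ha hb
  induction hab with
  | refl => exact .refl
  | @tail u v _ huv ih =>
    have : π u = π v ∨ u ∈ Set.Icc lo hi ∧ v ∈ Set.Icc lo hi := by
      rcases huv.ne.lt_or_gt with h' | h'
      · exact collapse u v huv h'
      · exact (collapse v u huv.symm h').imp Eq.symm And.symm
    rcases this with e | ⟨hu, hv⟩
    · rwa [← e]
    · refine ih.tail ⟨hπ u, hπ v, ?_⟩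
      rwa [hπ_eq u hu, hπ_eq v hv]

/-- Under the same condition, consecutive alternatives outside of the open interval are joined. -/
theorem adj_of_covBy_of_connected (hG : G.Connected)
    (hjump : ∀ u v c, G.Adj u v → u < c → c < v → lo < c ∧ c < hi) {a b : X} (hab : a ⋖ b)
    (ho : b ≤ lo ∨ hi ≤ a) : G.Adj a b := by
  have cross : ∀ w, Relation.ReflTransGen G.Adj a w →
      w < b ∨ ∃ u v, G.Adj u v ∧ u < b ∧ b ≤ v := by
    intro w hw
    induction hw with
    | refl => exact Or.inl hab.lt
    | @tail u v _ huv ih =>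
      refine ih.elim (fun hu => ?_) Or.inr
      exact (lt_or_ge v b).imp id fun hv => ⟨u, v, huv, hu, hv⟩
  obtain ⟨u, v, huv, hub, hbv⟩ := (cross b
    ((SimpleGraph.reachable_iff_reflTransGen a b).1 (hG.preconnected a b))).resolve_left
    (lt_irrefl _)
  have hua : u ≤ a := hab.le_of_lt hub
  rcases hua.eq_or_lt with rfl | hua
  · rcases hbv.eq_or_lt with rfl | hbv
    · exact huv
    · have := hjump u v b huv hub hbv
      exact absurd this fun h' => ho.elim (fun e => e.not_gt h'.1)
        fun e => (e.trans_lt hab.lt).not_gt h'.2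
  · have := hjump u v a huv hua (hab.lt.trans_le hbv)
    exact absurd this fun h' => ho.elim (fun e => (hab.lt.trans_le e).not_gt h'.1)
      fun e => e.not_gt h'.2

end CoreGraph

theorem MultidimHybridDomain.hybridDomain {m : ℕ} {A : Fin m → Type*} [∀ s, Finite (A s)]
    [∀ s, Nonempty (A s)] [∀ s, LinearOrder (A s)] {D : Set (Pref (∀ s, A s))}
    (hrich : MinimallyRich D) {lo hi : ∀ s, A s} (hD : MultidimHybridDomain lo hi D) (s : Fin m) :
    HybridDomain (inducedDomain D s) (min (lo s) (hi s)) (max (lo s) (hi s)) fun u v =>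
      u ∈ Set.uIcc (lo s) (hi s) ∧ v ∈ Set.uIcc (lo s) (hi s) ∧
        (strongGraph (inducedDomain D s)).Adj u v := by
  have hrel : ∀ P : inducedDomain D s, ∀ a b, a ∈ intBetween P.1.top b →
      ¬ (min (lo s) (hi s) < a ∧ a < max (lo s) (hi s)) → P.1.rel a b := by
    rintro ⟨_, P, hP, rfl⟩ a b hab ho
    simp only [Pref.marginal_top] at hab ⊢
    have hne : a ≠ b := by
      rcases hab with h | h
      · exact h.2.ne
      · exact h.1.ne'
    refine (hD.hybrid P hP (Function.update P.top s a) (Function.update P.top s b) s ?_).2 ?_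
    · ext k
      by_cases hk : k = s
      · subst hk; simpa [disagreement] using hne
      · simp [disagreement, hk]
    · refine ⟨by simpa using hab, fun h' => ho ?_⟩
      rw [Function.update_self] at h'
      rcases h' with h' | h'
      · exact ⟨(min_le_left _ _).trans_lt h'.1, h'.2.trans_le (le_max_right _ _)⟩
      · exact ⟨(min_le_right _ _).trans_lt h'.1, h'.2.trans_le (le_max_left _ _)⟩
  have hswap : ∀ u v, (strongGraph (inducedDomain D s)).Adj u v →
      ∃ P Q : inducedDomain D s, SwapPair P.1 Q.1 u v := by
    rintro u v ⟨P, hP, Q, hQ, hS⟩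
    exact ⟨⟨P, hP⟩, ⟨Q, hQ⟩, hS.swapPair⟩
  have hjump : ∀ u v c, (strongGraph (inducedDomain D s)).Adj u v → u < c → c < v →
      min (lo s) (hi s) < c ∧ c < max (lo s) (hi s) := by
    intro u v c huv huc hcv
    -- A preference with `u` first and `v` second cannot place an intermediate `c` above `v`, as
    -- single-peakedness at `c` would require.
    obtain ⟨P, Q, hS⟩ := hswap u v huv
    by_contra ho
    exact P.1.asymm (hS.second_left c huc.ne' hcv.ne)
      (hrel P c v (Or.inl ⟨hS.top_left ▸ huc, hcv⟩) ho)
  have hrich' : ∀ a, ∃ P : inducedDomain D s, P.1.top = a := by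
    intro a
    obtain ⟨P, hP, hPa⟩ := hrich (Function.update (fun k => Classical.arbitrary (A k)) s a)
    exact ⟨⟨_, P, hP, rfl⟩, by simp [Pref.marginal_top, hPa]⟩
  refine ⟨min_le_max, hrich', hrel, fun a b hab ho => ?_, fun hlh => ?_⟩
  · exact hswap a b (adj_of_covBy_of_connected (hD.connected s) hjump hab ho)
  · refine ⟨hrich', fun a b h => ⟨h.2.1, h.1, h.2.2.symm⟩, fun a b h => h.2.1,
      fun a b h => hswap a b h.2.2, fun a ha b hb =>
        reflTransGen_Icc_of_connected min_le_max (hD.connected s) hjump ha hb, fun a b h => ?_⟩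
    by_contra hc
    refine hD.no_leaf s (fun e => by simp [e] at hlh) ⟨⟨b, h.2.1⟩, ⟨a, h.1⟩, h.2.2.symm, ?_⟩
    rintro ⟨c, hcC⟩ hbc
    by_contra hne
    exact hc ⟨c, fun e => hne (Subtype.ext e), h.2.1, hcC, hbc⟩

theorem proposition1 {m : ℕ} (hm : 2 ≤ m) (A : Fin m → Type*)
    [∀ s, Finite (A s)] [∀ s, Nontrivial (A s)] [∀ s, LinearOrder (A s)]
    (D : Set (Pref (∀ s, A s))) (hrich : MinimallyRich D)
    (lo hi : ∀ s, A s) (hD : MultidimHybridDomain lo hi D)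
    (n : ℕ) (hn : 2 ≤ n) (s : Fin m) (f : (Fin n → inducedDomain D s) → A s) :
    (lo s = hi s → (StrategyProofRule f ↔ IsFBR f)) ∧
    (lo s ≠ hi s →
      (StrategyProofRule f ↔ IsConstrainedFBR (min (lo s) (hi s)) (max (lo s) (hi s)) f)) := by
  have K := hD.hybridDomain hrich s
  refine ⟨fun heq => ⟨fun hf => ?_, ?_⟩, fun hne => ⟨fun hf => ?_, ?_⟩⟩
  · obtain ⟨b, hb, -, hfb⟩ := hf.exists_ballots K (by omega)
    exact ⟨b, hb, hfb⟩
  · rintro ⟨b, hb, hfb⟩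
    exact hb.strategyProofRule K (fun h => by simp [heq] at h) hfb
  · obtain ⟨b, hb, hcd, hfb⟩ := hf.exists_ballots K (by omega)
    exact ⟨b, hb, hcd (min_lt_max.2 hne), hfb⟩
  · rintro ⟨b, hb, hcd, hfb⟩
    exact hb.strategyProofRule K (fun _ => hcd) hfb
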